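/- Let $1 \le q \le n$ and $r \ge 0$ be integers, let $D \subset \mathbb{R}^n$ be a domain (a non-empty connected open set), and let $E = D \times \mathbb{R}^r$ be the trivial vector bundle over $D$ with its standard frame $e_1,\dots,e_r$. A $C^2$ Riemannian metric on $E$ is a $C^2$ map $g$ from $D$ to the symmetric positive definite real $r\times r$ matrices, with $g_{\tau\xi} = \langle e_\tau, e_\xi\rangle$. Its curvature operator acts on $E$-valued $q$-forms $\alpha = \sum_\tau \sum_{|I|=q} \alpha_{I,\tau}\, dx_I \otimes e_\tau$ ($I$ increasing) by $$\Theta_g\,\alpha = -\sum_{i,j=1}^n dx_i \wedge \left( \frac{\partial}{\partial x_j} \,\lrcorner\, \left[ \frac{\partial}{\partial x_i}\left(g^{-1} \frac{\partial g}{\partial x_j}\right)\alpha \right] \right),$$ where the matrix $\frac{\partial}{\partial x_i}\big(g^{-1} \frac{\partial g}{\partial x_j}\big)$ acts on the column vectors $(\alpha_{I,\tau})_\tau$. Put $\langle \alpha, \beta\rangle_g = \sum_I \sum_{\tau,\xi} \alpha_{I,\tau}\, \beta_{I,\xi}\, g_{\tau\xi}$. The pair $(E,g)$ is called Nakano $q$-semipositive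 if $\langle \Theta_g\alpha, \alpha\rangle_g \ge 0$ at every point of $D$ for every $E$-valued $q$-form $\alpha$. Theorem. Let $(g_j)$ be a sequence of $C^2$ Riemannian metrics on $E$ such that every $(E,g_j)$ is Nakano $q$-semipositive. Assume that $(g_j)$ converges increasingly to a $C^2$ Riemannian metric $g$ on $E$; that is, $g_i \le g_j \le g$ on $D$ whenever $i \le j$ (in the sense that the differences are positive semidefinite matrices at every point), and $g_j(x) \to g(x)$ for every $x \in D$. Then $(E,g)$ is Nakano $q$-semipositive. -/

import Mathlib

open Filter Topology
open scoped Matrix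

noncomputable section

namespace RiemannianBundle

/-- The partial derivative `∂f/∂x_i` at `x` of a real function on `ℝⁿ`. -/
def partialDeriv {n : ℕ} (i : Fin n) (f : EuclideanSpace ℝ (Fin n) → ℝ)
    (x : EuclideanSpace ℝ (Fin n)) : ℝ :=
  fderiv ℝ f x (EuclideanSpace.single i 1)

/-- The entrywise partial derivative `∂A/∂x_i` at `x` of a matrix-valued function on `ℝⁿ`. -/
def matrixPartialDeriv {n r : ℕ} (i : Fin n)
    (A : EuclideanSpace ℝ (Fin n) → Matrix (Fin r) (Fin r) ℝ)
    (x : EuclideanSpace ℝ (Fin n)) : Matrix (Fin r) (Fin r) ℝ :=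
  Matrix.of fun τ ξ => partialDeriv i (fun y => A y τ ξ) x

/-- `g` is a `C²` Riemannian metric on the trivial bundle `D × ℝ^r`: its entries
`g_{τξ} = ⟨e_τ, e_ξ⟩` are `C²` on `D` and `g x` is symmetric positive definite for `x ∈ D`. -/
structure IsC2Metric {n r : ℕ} (D : Set (EuclideanSpace ℝ (Fin n)))
    (g : EuclideanSpace ℝ (Fin n) → Matrix (Fin r) (Fin r) ℝ) : Prop where
  contDiffOn : ∀ τ ξ, ContDiffOn ℝ 2 (fun x => g x τ ξ) D
  posDef : ∀ x ∈ D, (g x).PosDef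

/-- The fibre of `⨁_q Λ^q T*D ⊗ E`, for `D ⊆ ℝⁿ` and `E = D × ℝ^r`: the element
`∑_τ ∑_I α_{I,τ} dx_I ⊗ e_τ` is given by its coefficients `α I τ`, where a finite set
`I = {i_1 < ⋯ < i_q}` stands for the increasing multi-index with
`dx_I = dx_{i_1} ∧ ⋯ ∧ dx_{i_q}`. -/
abbrev FormFibre (n r : ℕ) : Type := Finset (Fin n) → Fin r → ℝ

/-- `α` is a `q`-form: only multi-indices of length `q` occur. -/
def FormFibre.IsDegree {n r : ℕ} (q : ℕ) (α : FormFibre n r) : Prop :=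
  ∀ I : Finset (Fin n), I.card ≠ q → α I = 0

/-- The sign `(-1)^{#{k ∈ I : k < i}}` of moving `dx_i` to its place in `dx_I`. -/
def insertSign {n : ℕ} (i : Fin n) (I : Finset (Fin n)) : ℝ :=
  (-1) ^ (I.filter (· < i)).card

/-- Interior product `∂/∂x_j ⌟ α`. The coefficient at `K` comes from
`∂/∂x_j ⌟ dx_{K ∪ {j}} = (-1)^{#{k ∈ K : k < j}} dx_K` for `j ∉ K`. -/
def interior {n r : ℕ} (j : Fin n) (α : FormFibre n r) : FormFibre n r :=
  fun K => if j ∈ K then 0 else insertSign j K • α (insert j K)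

/-- Exterior product `dx_i ∧ β`. The coefficient at `I` comes from
`dx_i ∧ dx_{I \ {i}} = (-1)^{#{k ∈ I : k < i}} dx_I` for `i ∈ I`. -/
def wedge {n r : ℕ} (i : Fin n) (β : FormFibre n r) : FormFibre n r :=
  fun I => if i ∈ I then insertSign i I • β (I.erase i) else 0

/-- The pointwise inner product `⟨α, β⟩_g = ∑_I ∑_{τ,ξ} α_{I,τ} β_{I,ξ} g_{τξ}` for the value
`G` of the metric at the point. -/
def fibreInner {n r : ℕ} (G : Matrix (Fin r) (Fin r) ℝ) (α β : FormFibre n r) : ℝ :=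
  ∑ I : Finset (Fin n), ∑ τ : Fin r, ∑ ξ : Fin r, α I τ * β I ξ * G τ ξ

/-- The endomorphism coefficients `-∂/∂x_i (g⁻¹ ∂g/∂x_j)` of the curvature, at `x`; they act on
column vectors of `ℝ^r`. -/
def curvatureCoeff {n r : ℕ} (g : EuclideanSpace ℝ (Fin n) → Matrix (Fin r) (Fin r) ℝ)
    (i j : Fin n) (x : EuclideanSpace ℝ (Fin n)) : Matrix (Fin r) (Fin r) ℝ :=
  -matrixPartialDeriv i (fun y => (g y)⁻¹ * matrixPartialDeriv j g y) x

/-- The curvature operator `Θ_E = -∑_{i,j} ∂/∂x_i (g⁻¹ ∂g/∂x_j) dx_i ∧ ∂/∂x_j ⌟` at `x`. -/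
def curvatureOperator {n r : ℕ} (g : EuclideanSpace ℝ (Fin n) → Matrix (Fin r) (Fin r) ℝ)
    (x : EuclideanSpace ℝ (Fin n)) (α : FormFibre n r) : FormFibre n r :=
  ∑ i : Fin n, ∑ j : Fin n,
    wedge i (interior j fun I => curvatureCoeff g i j x *ᵥ α I)

/-- `(D × ℝ^r, g)` is Nakano `q`-semipositive: `⟨Θ_E α, α⟩_g ≥ 0` at every point of `D` for every
`E`-valued `q`-form `α`. -/
def IsNakanoSemipositive {n r : ℕ} (q : ℕ) (D : Set (EuclideanSpace ℝ (Fin n)))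
    (g : EuclideanSpace ℝ (Fin n) → Matrix (Fin r) (Fin r) ℝ) : Prop :=
  ∀ x ∈ D, ∀ α : FormFibre n r, α.IsDegree q →
    0 ≤ fibreInner (g x) (curvatureOperator g x α) α

end RiemannianBundle

end

/-!
The proof avoids `L²` estimates for `d`: it shows that the first derivatives of the metrics converge
in `L²_loc`, after which the curvature inequality passes to the limit as a distribution.

Let `h = g⁻¹` be the dual metric. Then `-∂ᵢ(g⁻¹ ∂ⱼg) = (∂ᵢ∂ⱼh - ∂ⱼh · g · ∂ᵢh) g`
(`IsC2Metric.curvatureCoeff_eq`), so with `β = g α` the number `⟨Θ α, α⟩_g` is a fixed linear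
combination, with coefficients quadratic in `β`, of the entries of `∂ᵢ∂ⱼh - ∂ⱼh · g · ∂ᵢh`
(`dualForm`). Semipositivity says that this is nonnegative for all constant `β` of degree `q`.

* For `β = dx_I ⊗ u` the quadratic terms have a sign, and semipositivity of `g_k` implies
  `∑_{i ∈ I} ∂ᵢ∂ᵢ ⟨h_k u, u⟩ ≥ 0` (`IsNakanoSemipositive.sum_partialDeriv_inv_nonneg`).
* By Dini's theorem `g_k → g` locally uniformly, hence also `h_k → h` (`tendsto_prod_metric`,
  `tendsto_prod_inv_metric`).
* Locally uniform convergence of functions subharmonic in the variables `xᵢ`, `i ∈ I`, to a `C²`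
  function forces `L²_loc` convergence of their derivatives in these variables
  (`tendsto_integral_mul_partialDeriv_sub_sq`). As `1 ≤ q ≤ n`, every index lies in some `I` with
  `q` elements, so all first derivatives of `h_k` converge in `L²_loc`.
* For a test function `χ ≥ 0`, the integral of `χ` times the form of `g_k` converges to that of `g`:
  two integrations by parts move the derivatives in `∂ᵢ∂ⱼh_k` to `χ`, and the products
  `∂ⱼh_k · g_k · ∂ᵢh_k` converge as distributions (`tendsto_integral_mul_mul_mul`). The limit form is
  continuous and nonnegative against every `χ ≥ 0`, hence nonnegative.
-/

namespace RiemannianBundle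

open MeasureTheory
open scoped ContDiff

variable {n r : ℕ}

/-! ### Test functions and integration by parts -/

/-- `χ` is a smooth function on `ℝⁿ` with compact support contained in `D`. -/
structure IsTestFunction (D : Set (EuclideanSpace ℝ (Fin n)))
    (χ : EuclideanSpace ℝ (Fin n) → ℝ) : Prop where
  contDiff : ContDiff ℝ ∞ χ
  hasCompactSupport : HasCompactSupport χ
  tsupport_subset : tsupport χ ⊆ D

variable {D : Set (EuclideanSpace ℝ (Fin n))} {χ f : EuclideanSpace ℝ (Fin n) → ℝ}

theorem IsTestFunction.partialDeriv (hχ : IsTestFunction D χ) (i : Fin n) :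
    IsTestFunction D (partialDeriv i χ) where
  contDiff := (hχ.contDiff.fderiv_right (m := ∞) (by simp)).clm_apply contDiff_const
  hasCompactSupport := hχ.hasCompactSupport.fderiv_apply (𝕜 := ℝ) _
  tsupport_subset := (tsupport_fderiv_apply_subset ℝ _).trans hχ.tsupport_subset

theorem IsTestFunction.continuous_mul (hD : IsOpen D) (hχ : IsTestFunction D χ)
    (hf : ContinuousOn f D) : Continuous fun x => χ x * f x :=
  (hχ.contDiff.continuous.continuousOn.mul hf).continuous_of_tsupport_subset hD
    ((tsupport_mul_subset_left).trans hχ.tsupport_subset)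

theorem IsTestFunction.integrable_mul (hD : IsOpen D) (hχ : IsTestFunction D χ)
    (hf : ContinuousOn f D) : Integrable fun x => χ x * f x :=
  (hχ.continuous_mul hD hf).integrable_of_hasCompactSupport hχ.hasCompactSupport.mul_right

theorem contDiffOn_partialDeriv {m k : WithTop ℕ∞} (hD : IsOpen D) (hf : ContDiffOn ℝ k f D)
    (hmk : m + 1 ≤ k) (i : Fin n) : ContDiffOn ℝ m (partialDeriv i f) D :=
  (hf.fderiv_of_isOpen hD hmk).clm_apply contDiffOn_const

theorem continuousOn_partialDeriv (hD : IsOpen D) (hf : ContDiffOn ℝ 2 f D) (i : Fin n) :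
    ContinuousOn (partialDeriv i f) D :=
  (contDiffOn_partialDeriv (m := 1) hD hf (by norm_num) i).continuousOn

theorem continuousOn_partialDeriv_partialDeriv (hD : IsOpen D) (hf : ContDiffOn ℝ 2 f D)
    (i j : Fin n) : ContinuousOn (partialDeriv i (partialDeriv j f)) D :=
  (contDiffOn_partialDeriv (m := 0) hD
    (contDiffOn_partialDeriv (m := 1) hD hf (by norm_num) j) (by norm_num) i).continuousOn

/-- Integration by parts; `f` is arbitrary outside `D`. -/
theorem integral_mul_partialDeriv (hD : IsOpen D) (hχ : IsTestFunction D χ)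
    (hf : ContDiffOn ℝ 1 f D) (i : Fin n) :
    ∫ x, χ x * partialDeriv i f x = -∫ x, partialDeriv i χ x * f x := by
  have hf' : ContinuousOn (partialDeriv i f) D :=
    (contDiffOn_partialDeriv (m := 0) hD hf (by norm_num) i).continuousOn
  refine integral_bilinear_hasLineDerivAt_right_eq_neg_left_of_integrable
    (B := ContinuousLinearMap.mul ℝ ℝ) (v := EuclideanSpace.single i 1)
    ((hχ.partialDeriv i).integrable_mul hD hf.continuousOn) (hχ.integrable_mul hD hf')
    (hχ.integrable_mul hD hf.continuousOn) (fun x _ => ?_) (fun x hx => ?_)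
  · exact ((hχ.contDiff.differentiable (by simp)) x).hasFDerivAt.hasLineDerivAt _
  · exact ((hf.differentiableOn one_ne_zero).differentiableAt
      (hD.mem_nhds (hχ.tsupport_subset hx))).hasFDerivAt.hasLineDerivAt _

theorem integral_mul_partialDeriv_partialDeriv (hD : IsOpen D) (hχ : IsTestFunction D χ)
    (hf : ContDiffOn ℝ 2 f D) (i j : Fin n) :
    ∫ x, χ x * partialDeriv i (partialDeriv j f) x =
      ∫ x, partialDeriv j (partialDeriv i χ) x * f x := by
  rw [integral_mul_partialDeriv hD hχ (contDiffOn_partialDeriv hD hf (by norm_num) j),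
    integral_mul_partialDeriv hD (hχ.partialDeriv i) (hf.of_le (by norm_num)), neg_neg]

theorem partialDeriv_mul {f h : EuclideanSpace ℝ (Fin n) → ℝ} {x : EuclideanSpace ℝ (Fin n)}
    (hf : DifferentiableAt ℝ f x) (hh : DifferentiableAt ℝ h x) (i : Fin n) :
    partialDeriv i (fun y => f y * h y) x = partialDeriv i f x * h x + f x * partialDeriv i h x := by
  simp only [partialDeriv, fderiv_fun_mul hf hh]
  simp; ring

theorem partialDeriv_sub {f h : EuclideanSpace ℝ (Fin n) → ℝ} {x : EuclideanSpace ℝ (Fin n)}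
    (hf : DifferentiableAt ℝ f x) (hh : DifferentiableAt ℝ h x) (i : Fin n) :
    partialDeriv i (fun y => f y - h y) x = partialDeriv i f x - partialDeriv i h x := by
  simp [partialDeriv, fderiv_fun_sub hf hh]

theorem partialDeriv_const_mul {f : EuclideanSpace ℝ (Fin n) → ℝ} {x : EuclideanSpace ℝ (Fin n)}
    (hf : DifferentiableAt ℝ f x) (c : ℝ) (i : Fin n) :
    partialDeriv i (fun y => c * f y) x = c * partialDeriv i f x := by
  simp [partialDeriv, fderiv_const_mul hf]

theorem partialDeriv_sum {ι : Type*} {s : Finset ι} {F : ι → EuclideanSpace ℝ (Fin n) → ℝ}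
    {x : EuclideanSpace ℝ (Fin n)} (hF : ∀ a ∈ s, DifferentiableAt ℝ (F a) x) (i : Fin n) :
    partialDeriv i (fun y => ∑ a ∈ s, F a y) x = ∑ a ∈ s, partialDeriv i (F a) x := by
  simp [partialDeriv, fderiv_fun_sum hF]

theorem partialDeriv_congr {f h : EuclideanSpace ℝ (Fin n) → ℝ} {x : EuclideanSpace ℝ (Fin n)}
    (hfh : f =ᶠ[𝓝 x] h) (i : Fin n) : partialDeriv i f x = partialDeriv i h x := by
  simp [partialDeriv, hfh.fderiv_eq]

/-- A Caccioppoli-type identity: integrate `½ ∂ᵢ∂ᵢ(w²) = (∂ᵢw)² + w ∂ᵢ∂ᵢw` against `χ`. -/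
theorem integral_mul_partialDeriv_sq (hD : IsOpen D) (hχ : IsTestFunction D χ)
    {w : EuclideanSpace ℝ (Fin n) → ℝ} (hw : ContDiffOn ℝ 2 w D) (i : Fin n) :
    ∫ x, χ x * partialDeriv i w x ^ 2 =
      (1 / 2) * (∫ x, partialDeriv i (partialDeriv i χ) x * w x ^ 2) -
        ∫ x, χ x * (w x * partialDeriv i (partialDeriv i w) x) := by
  have hw1 := contDiffOn_partialDeriv (m := 1) hD hw (by norm_num) i
  have hw0 : ContDiffOn ℝ 1 w D := hw.of_le (by norm_num)
  have hda {x} (hx : x ∈ D) : DifferentiableAt ℝ w x :=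
    (hw0.differentiableOn one_ne_zero).differentiableAt (hD.mem_nhds hx)
  have hdb {x} (hx : x ∈ D) : DifferentiableAt ℝ (partialDeriv i w) x :=
    (hw1.differentiableOn one_ne_zero).differentiableAt (hD.mem_nhds hx)
  have hsupp {φ : EuclideanSpace ℝ (Fin n) → ℝ} (hφ : IsTestFunction D φ) {x} (hx : x ∉ D) :
      φ x = 0 := image_eq_zero_of_notMem_tsupport fun h => hx (hφ.tsupport_subset h)
  have e1 := integral_mul_partialDeriv hD hχ (hw0.mul hw1) i
  have e2 := integral_mul_partialDeriv hD (hχ.partialDeriv i) (hw0.mul hw0) i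
  have e3 : ∫ x, χ x * partialDeriv i (fun y => w y * partialDeriv i w y) x =
      (∫ x, χ x * partialDeriv i w x ^ 2) +
        ∫ x, χ x * (w x * partialDeriv i (partialDeriv i w) x) := by
    rw [← integral_add (hχ.integrable_mul (f := fun x => partialDeriv i w x ^ 2) hD
        (hw1.continuousOn.pow 2))
      (hχ.integrable_mul (f := fun x => w x * partialDeriv i (partialDeriv i w) x) hD
        (hw.continuousOn.mul (continuousOn_partialDeriv_partialDeriv hD hw i i)))]
    refine integral_congr_ae (.of_forall fun x => ?_)
    by_cases hx : x ∈ D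
    · have := partialDeriv_mul (hda hx) (hdb hx) i
      simp only [this]; ring
    · simp [hsupp hχ hx]
  have e4 : ∫ x, partialDeriv i χ x * partialDeriv i (fun y => w y * w y) x =
      2 * ∫ x, partialDeriv i χ x * (w x * partialDeriv i w x) := by
    rw [← integral_const_mul]
    refine integral_congr_ae (.of_forall fun x => ?_)
    by_cases hx : x ∈ D
    · have := partialDeriv_mul (hda hx) (hda hx) i
      simp only [this]; ring
    · simp [hsupp (hχ.partialDeriv i) hx]
  have e5 : ∫ x, partialDeriv i (partialDeriv i χ) x * (w x * w x) =
      ∫ x, partialDeriv i (partialDeriv i χ) x * w x ^ 2 := by simp [sq]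
  linarith

/-! ### Convergence of gradients -/

theorem IsTestFunction.eventually_forall_abs_sub_lt (hD : IsOpen D) (hχ : IsTestFunction D χ)
    {F : ℕ → EuclideanSpace ℝ (Fin n) → ℝ} (hF : TendstoLocallyUniformlyOn F f atTop D)
    {ε : ℝ} (hε : 0 < ε) : ∀ᶠ k in atTop, ∀ x ∈ tsupport χ, |F k x - f x| < ε := by
  have := (tendstoLocallyUniformlyOn_iff_forall_isCompact hD).1 hF _ hχ.tsupport_subset
    hχ.hasCompactSupport
  filter_upwards [Metric.tendstoUniformlyOn_iff.1 this ε hε] with k hk x hx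
  rw [abs_sub_comm]; exact hk x hx

/-- If `s k → s` locally uniformly and all `s k` are subharmonic in the variables `xᵢ`, `i ∈ I`,
then the partial derivatives in these variables converge in `L²_loc`. With `w = s k - s`, the
identity `integral_mul_partialDeriv_sq` bounds the energy of `w` by `sup |w|` times a constant,
because `∫ χ ∑ ∂ᵢ∂ᵢ (s k) = ∫ (∑ ∂ᵢ∂ᵢ χ) (s k)` stays bounded. -/
theorem tendsto_integral_mul_partialDeriv_sub_sq (hD : IsOpen D) (hχ : IsTestFunction D χ)
    (hχ0 : ∀ x, 0 ≤ χ x) {s : ℕ → EuclideanSpace ℝ (Fin n) → ℝ}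
    {t : EuclideanSpace ℝ (Fin n) → ℝ} (hs : ∀ k, ContDiffOn ℝ 2 (s k) D)
    (ht : ContDiffOn ℝ 2 t D) (I : Finset (Fin n))
    (hsub : ∀ k, ∀ x ∈ D, 0 ≤ ∑ i ∈ I, partialDeriv i (partialDeriv i (s k)) x)
    (hlim : TendstoLocallyUniformlyOn s t atTop D) {i : Fin n} (hi : i ∈ I) :
    Tendsto (fun k => ∫ x, χ x * (partialDeriv i (s k) x - partialDeriv i t x) ^ 2)
      atTop (𝓝 0) := by
  set L : (EuclideanSpace ℝ (Fin n) → ℝ) → EuclideanSpace ℝ (Fin n) → ℝ :=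
    fun u x => ∑ i ∈ I, partialDeriv i (partialDeriv i u) x with hL
  have hLc {u} (hu : ContDiffOn ℝ 2 u D) : ContinuousOn (L u) D :=
    continuousOn_finsetSum _ fun i _ => continuousOn_partialDeriv_partialDeriv hD hu i i
  have hLχs : ∀ x, x ∉ tsupport χ → L χ x = 0 := fun x h =>
    Finset.sum_eq_zero fun i _ => image_eq_zero_of_notMem_tsupport fun h' => h
      (tsupport_fderiv_apply_subset ℝ _ (tsupport_fderiv_apply_subset ℝ _ h'))
  have hLsupp : tsupport (L χ) ⊆ tsupport χ :=
    closure_minimal (fun x hx => by_contra fun h => hx (hLχs x h)) (isClosed_tsupport _)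
  have hLχ : IsTestFunction D (L χ) :=
    ⟨ContDiff.sum fun i _ => ((hχ.partialDeriv i).partialDeriv i).contDiff,
      hχ.hasCompactSupport.of_isClosed_subset (isClosed_tsupport _) hLsupp,
      hLsupp.trans hχ.tsupport_subset⟩
  have hIBP {u} (hu : ContDiffOn ℝ 2 u D) : ∫ x, χ x * L u x = ∫ x, L χ x * u x := by
    simp only [hL, Finset.mul_sum, Finset.sum_mul]
    rw [integral_finsetSum _ fun i _ => hχ.integrable_mul hD
        (continuousOn_partialDeriv_partialDeriv hD hu i i),
      integral_finsetSum _ fun i _ => ((hχ.partialDeriv i).partialDeriv i).integrable_mul hD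
        hu.continuousOn]
    exact Finset.sum_congr rfl fun i _ => integral_mul_partialDeriv_partialDeriv hD hχ hu i i
  -- The sum over `I` of `integral_mul_partialDeriv_sq`.
  have hEnergy {u} (hu : ContDiffOn ℝ 2 u D) : ∑ i ∈ I, ∫ x, χ x * partialDeriv i u x ^ 2 =
      (1 / 2) * (∫ x, L χ x * u x ^ 2) - ∫ x, χ x * (u x * L u x) := by
    rw [Finset.sum_congr rfl fun i _ => integral_mul_partialDeriv_sq hD hχ hu i,
      Finset.sum_sub_distrib, ← Finset.mul_sum]
    simp only [hL, Finset.mul_sum, Finset.sum_mul]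
    rw [integral_finsetSum _ fun i _ => ((hχ.partialDeriv i).partialDeriv i).integrable_mul
        (f := fun x => u x ^ 2) hD (hu.continuousOn.pow 2),
      integral_finsetSum _ fun i _ => hχ.integrable_mul
        (f := fun x => u x * partialDeriv i (partialDeriv i u) x) hD
        (hu.continuousOn.mul (continuousOn_partialDeriv_partialDeriv hD hu i i)), Finset.mul_sum]
  have hLχi : Integrable (L χ) := hLχ.contDiff.continuous.integrable_of_hasCompactSupport
    hLχ.hasCompactSupport
  set C : ℝ := (3 / 2) * (∫ x, |L χ x|) + (∫ x, L χ x * t x) + 2 * ∫ x, χ x * |L t x| with hC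
  have key : ∀ ε : ℝ, 0 < ε → ε ≤ 1 → ∀ᶠ k in atTop,
      ∫ x, χ x * (partialDeriv i (s k) x - partialDeriv i t x) ^ 2 ≤ ε * C := by
    intro ε hε hε1
    filter_upwards [hχ.eventually_forall_abs_sub_lt hD hlim hε] with k hk
    set w : EuclideanSpace ℝ (Fin n) → ℝ := fun x => s k x - t x with hw
    have hwc : ContDiffOn ℝ 2 w D := (hs k).sub ht
    have hd {u : EuclideanSpace ℝ (Fin n) → ℝ} (hu : ContDiffOn ℝ 2 u D) {x} (hx : x ∈ D) :
        DifferentiableAt ℝ u x :=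
      (hu.differentiableOn two_ne_zero).differentiableAt (hD.mem_nhds hx)
    have hw1 {x} (hx : x ∈ D) (j) :
        partialDeriv j w x = partialDeriv j (s k) x - partialDeriv j t x :=
      partialDeriv_sub (hd (u := s k) (hs k) hx) (hd (u := t) ht hx) j
    have hw2 {x} (hx : x ∈ D) : L w x = L (s k) x - L t x := by
      simp only [hL, ← Finset.sum_sub_distrib]
      refine Finset.sum_congr rfl fun j _ => ?_
      have hd' {u : EuclideanSpace ℝ (Fin n) → ℝ} (hu : ContDiffOn ℝ 2 u D) :
          DifferentiableAt ℝ (partialDeriv j u) x :=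
        ((contDiffOn_partialDeriv (m := 1) hD hu (by norm_num) j).differentiableOn
          one_ne_zero).differentiableAt (hD.mem_nhds hx)
      rw [← partialDeriv_sub (hd' (hs k)) (hd' ht)]
      refine partialDeriv_congr ?_ j
      filter_upwards [hD.mem_nhds hx] with y hy using hw1 hy j
    have h0 : ∫ x, χ x * (partialDeriv i (s k) x - partialDeriv i t x) ^ 2 =
        ∫ x, χ x * partialDeriv i w x ^ 2 := by
      refine integral_congr_ae (.of_forall fun x => ?_)
      by_cases hx : x ∈ tsupport χ
      · simp only [hw1 (hχ.tsupport_subset hx)]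
      · simp [image_eq_zero_of_notMem_tsupport hx]
    have h1 : ∫ x, χ x * partialDeriv i w x ^ 2 ≤ ∑ i ∈ I, ∫ x, χ x * partialDeriv i w x ^ 2 :=
      Finset.single_le_sum (f := fun i => ∫ x, χ x * partialDeriv i w x ^ 2)
        (fun j _ => integral_nonneg fun x => mul_nonneg (hχ0 x) (sq_nonneg _)) hi
    have h2 : ∫ x, L χ x * w x ^ 2 ≤ ε * ∫ x, |L χ x| := by
      rw [← integral_const_mul]
      refine integral_mono (hLχ.integrable_mul hD (hwc.continuousOn.pow 2))
        (hLχi.abs.const_mul _) fun x => ?_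
      by_cases hx : x ∈ tsupport χ
      · have hwx := (hk x hx).le
        have : w x ^ 2 ≤ ε := by
          rw [← sq_abs]; nlinarith [abs_nonneg (w x)]
        calc L χ x * w x ^ 2 ≤ |L χ x| * w x ^ 2 := by gcongr; exact le_abs_self _
          _ ≤ |L χ x| * ε := by gcongr
          _ = ε * |L χ x| := mul_comm _ _
      · simp [hLχs x hx]
    -- Subharmonicity enters here: `-w ∑ ∂ᵢ∂ᵢw ≤ ε (∑ ∂ᵢ∂ᵢ(s k) + |∑ ∂ᵢ∂ᵢt|)`.
    have h3 : -∫ x, χ x * (w x * L w x) ≤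
        ε * ((∫ x, χ x * L (s k) x) + ∫ x, χ x * |L t x|) := by
      rw [← integral_add (hχ.integrable_mul hD (hLc (hs k)))
        (hχ.integrable_mul hD (hLc ht).abs), ← integral_const_mul, ← integral_neg]
      refine integral_mono (hχ.integrable_mul hD (hwc.continuousOn.mul (hLc hwc))).neg
        (((hχ.integrable_mul hD (hLc (hs k))).add
          (hχ.integrable_mul hD (hLc ht).abs)).const_mul _) fun x => ?_
      by_cases hx : x ∈ tsupport χ
      · have hwx := (hk x hx).le
        have hxD := hχ.tsupport_subset hx
        have hp := hsub k x hxD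
        have : -(w x * L w x) ≤ ε * (L (s k) x + |L t x|) := by
          calc -(w x * L w x) ≤ |w x| * |L w x| := by
                rw [← abs_mul]; exact neg_le_abs _
            _ ≤ ε * (L (s k) x + |L t x|) := by
                gcongr
                rw [hw2 hxD]
                exact (abs_sub _ _).trans_eq (by rw [abs_of_nonneg hp])
        simp only
        nlinarith [mul_le_mul_of_nonneg_left this (hχ0 x)]
      · simp [image_eq_zero_of_notMem_tsupport hx]
    have h4 : ∫ x, χ x * L (s k) x ≤ (∫ x, |L χ x|) + ∫ x, L χ x * t x := by
      rw [hIBP (hs k), ← integral_add hLχi.abs (hLχ.integrable_mul hD ht.continuousOn)]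
      refine integral_mono (hLχ.integrable_mul hD (hs k).continuousOn)
        (hLχi.abs.add (hLχ.integrable_mul hD ht.continuousOn)) fun x => ?_
      by_cases hx : x ∈ tsupport χ
      · have hwx := (hk x hx).le.trans hε1
        have : L χ x * (s k x - t x) ≤ |L χ x| := by
          calc _ ≤ |L χ x| * |s k x - t x| := by rw [← abs_mul]; exact le_abs_self _
            _ ≤ |L χ x| * 1 := by gcongr
            _ = _ := mul_one _
        simp only; linarith
      · simp [hLχs x hx]
    have h5 : 0 ≤ ∫ x, χ x * |L t x| :=
      integral_nonneg fun x => mul_nonneg (hχ0 x) (abs_nonneg _)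
    rw [h0]
    refine h1.trans ?_
    rw [hEnergy hwc, hC]
    nlinarith [mul_le_mul_of_nonneg_left h4 hε.le, mul_nonneg hε.le h5]
  refine Metric.tendsto_nhds.2 fun ε hε => ?_
  have hδ : 0 < min 1 (ε / (|C| + 1)) := by positivity
  filter_upwards [key _ hδ (min_le_left _ _)] with k hk
  rw [Real.dist_eq, sub_zero, abs_of_nonneg
    (integral_nonneg fun x => mul_nonneg (hχ0 x) (sq_nonneg _))]
  refine hk.trans_lt ?_
  have h1 : min 1 (ε / (|C| + 1)) * C ≤ ε / (|C| + 1) * |C| :=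
    (mul_le_mul_of_nonneg_left (le_abs_self _) hδ.le).trans
      (mul_le_mul_of_nonneg_right (min_le_right _ _) (abs_nonneg _))
  refine h1.trans_lt ?_
  rw [div_mul_eq_mul_div, div_lt_iff₀ (by positivity)]
  nlinarith

/-- The product of two `L²_loc`-convergent sequences and a locally uniformly convergent one
converges as a distribution. -/
theorem tendsto_integral_mul_mul_mul (hD : IsOpen D) (hχ : IsTestFunction D χ)
    (hχ0 : ∀ x, 0 ≤ χ x) {p q m : ℕ → EuclideanSpace ℝ (Fin n) → ℝ}
    {p' q' m' : EuclideanSpace ℝ (Fin n) → ℝ} (hp : ∀ k, ContinuousOn (p k) D)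
    (hq : ∀ k, ContinuousOn (q k) D) (hm : ∀ k, ContinuousOn (m k) D)
    (hp' : ContinuousOn p' D) (hq' : ContinuousOn q' D) (hm' : ContinuousOn m' D)
    (hpl : Tendsto (fun k => ∫ x, χ x * (p k x - p' x) ^ 2) atTop (𝓝 0))
    (hql : Tendsto (fun k => ∫ x, χ x * (q k x - q' x) ^ 2) atTop (𝓝 0))
    (hml : TendstoLocallyUniformlyOn m m' atTop D) :
    Tendsto (fun k => ∫ x, χ x * (p k x * m k x * q k x)) atTop
      (𝓝 (∫ x, χ x * (p' x * m' x * q' x))) := by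
  obtain ⟨M, hM⟩ := (IsCompact.exists_bound_of_continuousOn hχ.hasCompactSupport
    (hm'.mono hχ.tsupport_subset))
  set A : ℕ → ℝ := fun k => ∫ x, χ x * (p k x - p' x) ^ 2
  set B : ℕ → ℝ := fun k => ∫ x, χ x * (q k x - q' x) ^ 2
  set N : ℝ := |M| + 1 with hN
  set S : ℝ := (N + 1) / 2 * ∫ x, χ x * (p' x ^ 2 + q' x ^ 2) with hS
  have hS0 : 0 ≤ S := mul_nonneg (by positivity)
    (integral_nonneg fun x => mul_nonneg (hχ0 x) (by positivity))
  have key : ∀ δ : ℝ, 0 < δ → δ ≤ 1 → ∀ᶠ k in atTop,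
      |(∫ x, χ x * (p k x * m k x * q k x)) - ∫ x, χ x * (p' x * m' x * q' x)| ≤
        N * (1 / 2 + 1 / (2 * δ)) * (A k + B k) + δ * S := by
    intro δ hδ hδ1
    filter_upwards [hχ.eventually_forall_abs_sub_lt hD hml hδ] with k hk
    have i1 : Integrable fun x => χ x * (p k x * m k x * q k x) :=
      hχ.integrable_mul hD (((hp k).mul (hm k)).mul (hq k))
    have i2 : Integrable fun x => χ x * (p' x * m' x * q' x) :=
      hχ.integrable_mul hD ((hp'.mul hm').mul hq')
    have i3 : Integrable fun x => χ x * (p k x - p' x) ^ 2 :=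
      hχ.integrable_mul hD (((hp k).sub hp').pow 2)
    have i4 : Integrable fun x => χ x * (q k x - q' x) ^ 2 :=
      hχ.integrable_mul hD (((hq k).sub hq').pow 2)
    have i5 : Integrable fun x => χ x * (p' x ^ 2 + q' x ^ 2) :=
      hχ.integrable_mul hD ((hp'.pow 2).add (hq'.pow 2))
    have i34 : Integrable fun x => χ x * (p k x - p' x) ^ 2 + χ x * (q k x - q' x) ^ 2 :=
      i3.add i4
    simp only [A, B, hS]
    rw [← integral_sub i1 i2, ← integral_add i3 i4, ← mul_assoc δ, ← integral_const_mul,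
      ← integral_const_mul,
      ← integral_add (i34.const_mul (N * (1 / 2 + 1 / (2 * δ))))
        (i5.const_mul (δ * ((N + 1) / 2)))]
    refine (abs_integral_le_integral_abs).trans (integral_mono (i1.sub i2).abs
      ((i34.const_mul _).add (i5.const_mul _)) fun x => ?_)
    by_cases hx : x ∈ tsupport χ
    · have h1 := hk x hx
      have h2 : |m' x| ≤ |M| := (hM x hx).trans (le_abs_self M)
      have h3 : |m k x| ≤ N := by
        have := abs_sub_abs_le_abs_sub (m k x) (m' x); rw [hN]; linarith
      have h4 : |p k x * m k x * q k x - p' x * m' x * q' x| ≤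
          N * (1 / 2 + 1 / (2 * δ)) * ((p k x - p' x) ^ 2 + (q k x - q' x) ^ 2) +
            δ * ((N + 1) / 2) * (p' x ^ 2 + q' x ^ 2) := by
        have e : p k x * m k x * q k x - p' x * m' x * q' x =
          m k x * ((p k x - p' x) * (q k x - q' x) + p' x * (q k x - q' x) +
            (p k x - p' x) * q' x) + (m k x - m' x) * (p' x * q' x) := by ring
        generalize p k x - p' x = a at *
        generalize q k x - q' x = b at *
        generalize p' x = c at *
        generalize q' x = d at *
        -- Weighted AM-GM replaces the Cauchy–Schwarz inequality for the cross terms.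
        have amgm (u v : ℝ) : |u * v| ≤ δ / 2 * u ^ 2 + 1 / (2 * δ) * v ^ 2 := by
          have e1 : δ / 2 * u ^ 2 + 1 / (2 * δ) * v ^ 2 =
            (2 * (δ * u) * v + (δ * u - v) ^ 2) / (2 * δ) := by field_simp; ring
          have e2 : δ / 2 * u ^ 2 + 1 / (2 * δ) * v ^ 2 =
            (-(2 * (δ * u) * v) + (δ * u + v) ^ 2) / (2 * δ) := by field_simp; ring
          rw [abs_le]
          constructor
          · rw [neg_le, e2, le_div_iff₀ (by positivity)]; nlinarith [sq_nonneg (δ * u + v)]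
          · rw [e1, le_div_iff₀ (by positivity)]; nlinarith [sq_nonneg (δ * u - v)]
        have hab : |a * b| ≤ 1 / 2 * (a ^ 2 + b ^ 2) := by
          rw [abs_le]; constructor <;> nlinarith [sq_nonneg (a - b), sq_nonneg (a + b)]
        have hcd : |c * d| ≤ 1 / 2 * (c ^ 2 + d ^ 2) := by
          rw [abs_le]; constructor <;> nlinarith [sq_nonneg (c - d), sq_nonneg (c + d)]
        have hcb := amgm c b
        have had := amgm d a
        rw [mul_comm d a] at had
        have t1 : |a * b + c * b + a * d| ≤
            (1 / 2 + 1 / (2 * δ)) * (a ^ 2 + b ^ 2) + δ / 2 * (c ^ 2 + d ^ 2) := by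
          refine (abs_add_three _ _ _).trans ?_
          linarith
        rw [e]
        refine (abs_add_le _ _).trans ?_
        rw [abs_mul, abs_mul]
        have t2 : |m k x| * |a * b + c * b + a * d| ≤
            N * ((1 / 2 + 1 / (2 * δ)) * (a ^ 2 + b ^ 2) + δ / 2 * (c ^ 2 + d ^ 2)) := by
          gcongr
        have t3 : |m k x - m' x| * |c * d| ≤ δ * (1 / 2 * (c ^ 2 + d ^ 2)) := by
          gcongr
        linarith
      have h5 := mul_le_mul_of_nonneg_left h4 (hχ0 x)
      simp only
      rw [← mul_sub, abs_mul, abs_of_nonneg (hχ0 x)]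
      linarith
    · simp [image_eq_zero_of_notMem_tsupport hx]
  refine Metric.tendsto_nhds.2 fun ε hε => ?_
  set δ : ℝ := min 1 (ε / (2 * (S + 1))) with hδ
  have hδ0 : 0 < δ := by positivity
  have hAB : Tendsto (fun k => N * (1 / 2 + 1 / (2 * δ)) * (A k + B k)) atTop (𝓝 0) := by
    simpa using (hpl.add hql).const_mul (N * (1 / 2 + 1 / (2 * δ)))
  filter_upwards [key δ hδ0 (min_le_left _ _), hAB.eventually (gt_mem_nhds (half_pos hε))]
    with k h1 h2
  have h3 : δ * S ≤ ε / 2 := by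
    calc δ * S ≤ ε / (2 * (S + 1)) * (S + 1) := by
          gcongr
          · exact min_le_right _ _
          · linarith
      _ = ε / 2 := by field_simp
  rw [Real.dist_eq]
  linarith

/-! ### Matrix-valued functions and the inverse metric -/

theorem contDiffOn_det {A : EuclideanSpace ℝ (Fin n) → Matrix (Fin r) (Fin r) ℝ}
    {k : WithTop ℕ∞} (hA : ∀ τ ξ, ContDiffOn ℝ k (fun x => A x τ ξ) D) :
    ContDiffOn ℝ k (fun x => (A x).det) D := by
  simp only [Matrix.det_apply, Units.smul_def, zsmul_eq_mul]
  exact ContDiffOn.sum fun σ _ => contDiffOn_const.mul (contDiffOn_prod fun τ _ => hA _ _)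

theorem IsC2Metric.isUnit_det {g : EuclideanSpace ℝ (Fin n) → Matrix (Fin r) (Fin r) ℝ}
    (hg : IsC2Metric D g) {x : EuclideanSpace ℝ (Fin n)} (hx : x ∈ D) : IsUnit (g x).det :=
  (hg.posDef x hx).det_pos.ne'.isUnit

theorem IsC2Metric.contDiffOn_inv {g : EuclideanSpace ℝ (Fin n) → Matrix (Fin r) (Fin r) ℝ}
    (hg : IsC2Metric D g) (τ ξ : Fin r) : ContDiffOn ℝ 2 (fun x => (g x)⁻¹ τ ξ) D := by
  simp only [Matrix.inv_def, Matrix.smul_apply, Ring.inverse_eq_inv', smul_eq_mul]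
  refine ((contDiffOn_det hg.contDiffOn).inv fun x hx => (hg.isUnit_det hx).ne_zero).mul ?_
  simp only [Matrix.adjugate_apply]
  refine contDiffOn_det fun a b => ?_
  by_cases h : a = ξ
  · subst h; simpa [Matrix.updateRow_self] using contDiffOn_const
  · simpa [Matrix.updateRow_ne h] using hg.contDiffOn a b

theorem IsC2Metric.isSymm_inv {g : EuclideanSpace ℝ (Fin n) → Matrix (Fin r) (Fin r) ℝ}
    (hg : IsC2Metric D g) {x : EuclideanSpace ℝ (Fin n)} (hx : x ∈ D) (τ ξ : Fin r) :
    (g x)⁻¹ τ ξ = (g x)⁻¹ ξ τ := by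
  simpa using ((hg.posDef x hx).isHermitian.inv.apply τ ξ).symm

theorem matrixPartialDeriv_mul {A B : EuclideanSpace ℝ (Fin n) → Matrix (Fin r) (Fin r) ℝ}
    {x : EuclideanSpace ℝ (Fin n)} (hA : ∀ τ ξ, DifferentiableAt ℝ (fun y => A y τ ξ) x)
    (hB : ∀ τ ξ, DifferentiableAt ℝ (fun y => B y τ ξ) x) (i : Fin n) :
    matrixPartialDeriv i (fun y => A y * B y) x =
      matrixPartialDeriv i A x * B x + A x * matrixPartialDeriv i B x := by
  ext τ ξ
  simp only [matrixPartialDeriv, Matrix.of_apply, Matrix.mul_apply, Matrix.add_apply]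
  rw [partialDeriv_sum fun a _ => (hA τ a).fun_mul (hB a ξ), ← Finset.sum_add_distrib]
  exact Finset.sum_congr rfl fun a _ => partialDeriv_mul (hA τ a) (hB a ξ) i

theorem matrixPartialDeriv_congr {A B : EuclideanSpace ℝ (Fin n) → Matrix (Fin r) (Fin r) ℝ}
    {x : EuclideanSpace ℝ (Fin n)} (h : A =ᶠ[𝓝 x] B) (i : Fin n) :
    matrixPartialDeriv i A x = matrixPartialDeriv i B x := by
  ext τ ξ
  exact partialDeriv_congr (h.mono fun y hy => by simp only [hy]) i

/-- The matrix `∂ᵢ∂ⱼ h - ∂ⱼh · g · ∂ᵢh` with `h = g⁻¹`: the curvature coefficient of `g` is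
this matrix times `g`, see `IsC2Metric.curvatureCoeff_eq`. -/
noncomputable def dualCoeff (g : EuclideanSpace ℝ (Fin n) → Matrix (Fin r) (Fin r) ℝ) (i j : Fin n)
    (x : EuclideanSpace ℝ (Fin n)) : Matrix (Fin r) (Fin r) ℝ :=
  matrixPartialDeriv i (matrixPartialDeriv j fun y => (g y)⁻¹) x -
    matrixPartialDeriv j (fun y => (g y)⁻¹) x * g x * matrixPartialDeriv i (fun y => (g y)⁻¹) x

theorem IsC2Metric.curvatureCoeff_eq {g : EuclideanSpace ℝ (Fin n) → Matrix (Fin r) (Fin r) ℝ}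
    (hD : IsOpen D) (hg : IsC2Metric D g) {x : EuclideanSpace ℝ (Fin n)} (hx : x ∈ D)
    (i j : Fin n) : curvatureCoeff g i j x = dualCoeff g i j x * g x := by
  set h : EuclideanSpace ℝ (Fin n) → Matrix (Fin r) (Fin r) ℝ := fun y => (g y)⁻¹ with hh
  have hdiff {f : EuclideanSpace ℝ (Fin n) → ℝ} (hf : ContDiffOn ℝ 1 f D)
      {y : EuclideanSpace ℝ (Fin n)} (hy : y ∈ D) : DifferentiableAt ℝ f y :=
    (hf.differentiableOn one_ne_zero).differentiableAt (hD.mem_nhds hy)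
  have dg {y} (hy : y ∈ D) (τ ξ) : DifferentiableAt ℝ (fun z => g z τ ξ) y :=
    hdiff ((hg.contDiffOn τ ξ).of_le (by norm_num)) hy
  have dh {y} (hy : y ∈ D) (τ ξ) : DifferentiableAt ℝ (fun z => h z τ ξ) y :=
    hdiff ((hg.contDiffOn_inv τ ξ).of_le (by norm_num)) hy
  have ddh (j τ ξ) : DifferentiableAt ℝ (fun z => matrixPartialDeriv j h z τ ξ) x :=
    hdiff (contDiffOn_partialDeriv hD (hg.contDiffOn_inv τ ξ) (by norm_num) j) hx
  -- Differentiate `g⁻¹ g = 1`.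
  have h1 (j) {y} (hy : y ∈ D) :
      h y * matrixPartialDeriv j g y = -(matrixPartialDeriv j h y * g y) := by
    have e := matrixPartialDeriv_mul (dh hy) (dg hy) j
    have e0 : matrixPartialDeriv j (fun z => h z * g z) y = 0 := by
      rw [matrixPartialDeriv_congr (B := fun _ => 1)]
      · ext τ ξ; simp [matrixPartialDeriv, partialDeriv]
      · filter_upwards [hD.mem_nhds hy] with z hz
        exact Matrix.nonsing_inv_mul _ (hg.isUnit_det hz)
    rw [e0] at e
    exact eq_neg_of_add_eq_zero_right e.symm
  have h2 : matrixPartialDeriv i g x = -(g x * matrixPartialDeriv i h x * g x) := by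
    have e : g x * (h x * matrixPartialDeriv i g x) = g x * -(matrixPartialDeriv i h x * g x) := by
      rw [h1 i hx]
    rwa [← mul_assoc, Matrix.mul_nonsing_inv _ (hg.isUnit_det hx), one_mul, mul_neg,
      ← mul_assoc] at e
  have h3 : curvatureCoeff g i j x =
      matrixPartialDeriv i (fun y => matrixPartialDeriv j h y * g y) x := by
    rw [curvatureCoeff, matrixPartialDeriv_congr
      (B := fun y => -(matrixPartialDeriv j h y * g y))]
    · ext τ ξ
      simp [matrixPartialDeriv, partialDeriv, fderiv_fun_neg]
    · filter_upwards [hD.mem_nhds hx] with y hy using h1 j hy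
  rw [h3, matrixPartialDeriv_mul (ddh j) (dg hx), h2, dualCoeff]
  simp only [mul_neg, sub_mul, mul_assoc]
  abel

/-! ### The curvature form in terms of the dual metric -/

/-- The sign with which the `J`-coefficient, `J = (I \ {i}) ∪ {j}`, enters the `I`-coefficient of
`dx_i ∧ (∂/∂x_j ⌟ ·)`. -/
noncomputable def exchangeSign (I : Finset (Fin n)) (i j : Fin n) : ℝ :=
  if i ∈ I ∧ j ∉ I.erase i then insertSign i I * insertSign j (I.erase i) else 0

theorem wedge_interior_apply (i j : Fin n) (α : FormFibre n r) (I : Finset (Fin n)) :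
    wedge i (interior j α) I = exchangeSign I i j • α (insert j (I.erase i)) := by
  by_cases hi : i ∈ I <;> by_cases hj : j ∈ I.erase i <;>
    simp [wedge, interior, exchangeSign, hi, hj, smul_smul]

theorem fibreInner_eq_sum (G : Matrix (Fin r) (Fin r) ℝ) (α β : FormFibre n r) :
    fibreInner G α β = ∑ I, α I ⬝ᵥ (G *ᵥ β I) := by
  simp only [fibreInner, dotProduct, Matrix.mulVec, Finset.mul_sum]
  exact Finset.sum_congr rfl fun I _ => Finset.sum_congr rfl fun τ _ =>
    Finset.sum_congr rfl fun ξ _ => by ring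

/-- The curvature form `⟨Θ α, α⟩_g` as a function of `β = g α`. -/
noncomputable def dualForm (g : EuclideanSpace ℝ (Fin n) → Matrix (Fin r) (Fin r) ℝ)
    (β : FormFibre n r) (x : EuclideanSpace ℝ (Fin n)) : ℝ :=
  ∑ I, ∑ i, ∑ j, exchangeSign I i j *
    ((dualCoeff g i j x *ᵥ β (insert j (I.erase i))) ⬝ᵥ β I)

/-- The matrix `g` on the right of `curvatureCoeff_eq` turns `α` into `g α`, and pairing with `α`
through `g` turns the second `α` into `g α` too. -/
theorem IsC2Metric.fibreInner_curvatureOperator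
    {g : EuclideanSpace ℝ (Fin n) → Matrix (Fin r) (Fin r) ℝ}
    (hD : IsOpen D) (hg : IsC2Metric D g) {x : EuclideanSpace ℝ (Fin n)} (hx : x ∈ D)
    (α : FormFibre n r) :
    fibreInner (g x) (curvatureOperator g x α) α = dualForm g (fun I => g x *ᵥ α I) x := by
  rw [fibreInner_eq_sum, dualForm]
  refine Finset.sum_congr rfl fun I _ => ?_
  simp only [curvatureOperator, Finset.sum_apply, wedge_interior_apply, sum_dotProduct,
    smul_dotProduct, hg.curvatureCoeff_eq hD hx, smul_eq_mul, Matrix.mulVec_mulVec]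

theorem IsNakanoSemipositive.dualForm_nonneg {q : ℕ}
    {g : EuclideanSpace ℝ (Fin n) → Matrix (Fin r) (Fin r) ℝ} (hD : IsOpen D)
    (hg : IsC2Metric D g) (hpos : IsNakanoSemipositive q D g) {x : EuclideanSpace ℝ (Fin n)}
    (hx : x ∈ D) {β : FormFibre n r} (hβ : β.IsDegree q) : 0 ≤ dualForm g β x := by
  have h := hpos x hx (fun I => (g x)⁻¹ *ᵥ β I) fun I hI => by simp [hβ I hI]
  rw [hg.fibreInner_curvatureOperator hD hx] at h
  simpa [Matrix.mul_nonsing_inv _ (hg.isUnit_det hx)] using h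

/-- On `dx_I ⊗ u` only the diagonal terms `i = j ∈ I` survive, since `(I \ {i}) ∪ {j} = I` forces
`j = i`. -/
theorem dualForm_single (g : EuclideanSpace ℝ (Fin n) → Matrix (Fin r) (Fin r) ℝ)
    (x : EuclideanSpace ℝ (Fin n)) (I : Finset (Fin n)) (u : Fin r → ℝ) :
    dualForm g (Pi.single I u) x = ∑ i ∈ I, (dualCoeff g i i x *ᵥ u) ⬝ᵥ u := by
  rw [dualForm, Finset.sum_eq_single I (fun I' _ h => by simp [Pi.single_eq_of_ne h]) (by simp),
    ← Finset.sum_subset (Finset.subset_univ I) (fun i _ hi => by simp [exchangeSign, hi])]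
  refine Finset.sum_congr rfl fun i hi => ?_
  rw [Finset.sum_eq_single i]
  · have e : (I.erase i).filter (· < i) = I.filter (· < i) := by
      ext k
      simp only [Finset.mem_filter, Finset.mem_erase]
      exact ⟨fun h => ⟨h.1.2, h.2⟩, fun h => ⟨⟨h.2.ne, h.1⟩, h.2⟩⟩
    have e' : insertSign i I * insertSign i (I.erase i) = 1 := by
      rw [insertSign, insertSign, e, ← mul_pow]; simp
    simp [exchangeSign, hi, e', Finset.insert_erase hi]
  · intro j _ hj
    have : insert j (I.erase i) ≠ I := fun h => by
      have : i ∈ insert j (I.erase i) := by rw [h]; exact hi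
      simp [hj.symm] at this
    simp [Pi.single_eq_of_ne this]
  · simp

theorem partialDeriv_dotProduct_mulVec
    {A : EuclideanSpace ℝ (Fin n) → Matrix (Fin r) (Fin r) ℝ} {x : EuclideanSpace ℝ (Fin n)}
    (hA : ∀ τ ξ, DifferentiableAt ℝ (fun y => A y τ ξ) x) (u : Fin r → ℝ) (i : Fin n) :
    partialDeriv i (fun y => (A y *ᵥ u) ⬝ᵥ u) x = (matrixPartialDeriv i A x *ᵥ u) ⬝ᵥ u := by
  simp only [dotProduct, Matrix.mulVec, Finset.sum_mul, matrixPartialDeriv, Matrix.of_apply]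
  rw [partialDeriv_sum fun τ _ => by fun_prop]
  refine Finset.sum_congr rfl fun τ _ => ?_
  rw [partialDeriv_sum fun ξ _ => by fun_prop]
  refine Finset.sum_congr rfl fun ξ _ => ?_
  have := partialDeriv_const_mul (hA τ ξ) (u ξ * u τ) i
  rw [show (fun y => A y τ ξ * u ξ * u τ) = fun y => u ξ * u τ * A y τ ξ by ext; ring, this]
  ring

/-- Testing semipositivity on `dx_I ⊗ u`: the squared lengths of constant sections in the dual
metric are subharmonic in the variables `xᵢ`, `i ∈ I`, for every `I` with `q` elements. -/
theorem IsNakanoSemipositive.sum_partialDeriv_inv_nonneg {q : ℕ}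
    {g : EuclideanSpace ℝ (Fin n) → Matrix (Fin r) (Fin r) ℝ} (hD : IsOpen D)
    (hg : IsC2Metric D g) (hpos : IsNakanoSemipositive q D g) {x : EuclideanSpace ℝ (Fin n)}
    (hx : x ∈ D) {I : Finset (Fin n)} (hI : I.card = q) (u : Fin r → ℝ) :
    0 ≤ ∑ i ∈ I, partialDeriv i (partialDeriv i fun y => ((g y)⁻¹ *ᵥ u) ⬝ᵥ u) x := by
  have h := hpos.dualForm_nonneg hD hg hx (β := Pi.single I u) fun I' hI' => by
    have : I' ≠ I := fun e => hI' (by rw [e, hI])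
    simp [Pi.single_eq_of_ne this]
  rw [dualForm_single] at h
  refine h.trans (Finset.sum_le_sum fun i _ => ?_)
  have hdiff {f : EuclideanSpace ℝ (Fin n) → ℝ} (hf : ContDiffOn ℝ 1 f D)
      {y : EuclideanSpace ℝ (Fin n)} (hy : y ∈ D) : DifferentiableAt ℝ f y :=
    (hf.differentiableOn one_ne_zero).differentiableAt (hD.mem_nhds hy)
  have h1 : partialDeriv i (partialDeriv i fun y => ((g y)⁻¹ *ᵥ u) ⬝ᵥ u) x =
      (matrixPartialDeriv i (matrixPartialDeriv i fun y => (g y)⁻¹) x *ᵥ u) ⬝ᵥ u := by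
    rw [← partialDeriv_dotProduct_mulVec (A := matrixPartialDeriv i fun y => (g y)⁻¹) fun τ ξ =>
      hdiff (contDiffOn_partialDeriv hD (hg.contDiffOn_inv τ ξ) (by norm_num) i) hx]
    refine partialDeriv_congr ?_ i
    filter_upwards [hD.mem_nhds hx] with y hy
    exact partialDeriv_dotProduct_mulVec
      (fun τ ξ => hdiff ((hg.contDiffOn_inv τ ξ).of_le (by norm_num)) hy) u i
  have hsymm : (matrixPartialDeriv i (fun y => (g y)⁻¹) x)ᵀ =
      matrixPartialDeriv i (fun y => (g y)⁻¹) x := by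
    ext τ ξ
    refine partialDeriv_congr ?_ i
    filter_upwards [hD.mem_nhds hx] with y hy using hg.isSymm_inv hy ξ τ
  set P := matrixPartialDeriv i (fun y => (g y)⁻¹) x with hP
  -- As `P` is symmetric, this is the squared `g`-length of `P u`.
  have h2 : 0 ≤ ((P * g x * P) *ᵥ u) ⬝ᵥ u := by
    have := (hg.posDef x hx).posSemidef.dotProduct_mulVec_nonneg (P *ᵥ u)
    rw [← Matrix.mulVec_mulVec, ← Matrix.mulVec_mulVec, dotProduct_comm, Matrix.dotProduct_mulVec,
      ← Matrix.mulVec_transpose, hsymm]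
    simpa using this
  rw [h1, dualCoeff, Matrix.sub_mulVec, sub_dotProduct]
  linarith

/-! ### Locally uniform convergence of the metrics and their inverses -/

/-- Towards a continuous limit, locally uniform convergence is joint convergence in the index and
the point. -/
theorem tendstoLocallyUniformlyOn_iff_tendsto_prod (hD : IsOpen D)
    {F : ℕ → EuclideanSpace ℝ (Fin n) → ℝ} {f : EuclideanSpace ℝ (Fin n) → ℝ}
    (hf : ContinuousOn f D) : TendstoLocallyUniformlyOn F f atTop D ↔
      ∀ x ∈ D, Tendsto (fun p : ℕ × EuclideanSpace ℝ (Fin n) => F p.1 p.2)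
        (atTop ×ˢ 𝓝 x) (𝓝 (f x)) := by
  rw [hD.tendstoLocallyUniformlyOn_iff_forall_tendsto]
  refine forall₂_congr fun x hx => ?_
  have h1 : Tendsto (fun p : ℕ × EuclideanSpace ℝ (Fin n) => f p.2) (atTop ×ˢ 𝓝 x) (𝓝 (f x)) :=
    (hf.continuousAt (hD.mem_nhds hx)).tendsto.comp tendsto_snd
  rw [tendsto_uniformity_iff_dist_tendsto_zero]
  refine ⟨fun h => tendsto_of_tendsto_of_dist h1 h, fun h => ?_⟩
  simpa using h1.dist h

theorem apply_eq_polarization {A : Matrix (Fin r) (Fin r) ℝ} (hA : ∀ τ ξ, A τ ξ = A ξ τ)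
    (τ ξ : Fin r) : A τ ξ = (1 / 2) *
      ((A *ᵥ (Pi.single τ 1 + Pi.single ξ 1)) ⬝ᵥ (Pi.single τ 1 + Pi.single ξ 1) -
        (A *ᵥ Pi.single τ 1) ⬝ᵥ Pi.single τ 1 - (A *ᵥ Pi.single ξ 1) ⬝ᵥ Pi.single ξ 1) := by
  simp [Matrix.mulVec_add]
  rw [hA ξ τ]
  ring

theorem continuous_mulVec_dotProduct (u : Fin r → ℝ) :
    Continuous fun A : Matrix (Fin r) (Fin r) ℝ => (A *ᵥ u) ⬝ᵥ u :=
  (continuous_id.matrix_mulVec continuous_const).dotProduct continuous_const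

theorem IsC2Metric.continuousOn {g : EuclideanSpace ℝ (Fin n) → Matrix (Fin r) (Fin r) ℝ}
    (hg : IsC2Metric D g) : ContinuousOn g D :=
  continuousOn_pi.2 fun τ => continuousOn_pi.2 fun ξ => (hg.contDiffOn τ ξ).continuousOn

/-- Dini's theorem for an increasing sequence of metrics. -/
theorem tendsto_prod_metric (hD : IsOpen D)
    {gs : ℕ → EuclideanSpace ℝ (Fin n) → Matrix (Fin r) (Fin r) ℝ}
    {g : EuclideanSpace ℝ (Fin n) → Matrix (Fin r) (Fin r) ℝ}
    (hgs : ∀ j, IsC2Metric D (gs j)) (hg : IsC2Metric D g)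
    (hmono : ∀ i j, i ≤ j → ∀ x ∈ D, (gs j x - gs i x).PosSemidef)
    (hlim : ∀ x ∈ D, Tendsto (fun j => gs j x) atTop (𝓝 (g x)))
    {x : EuclideanSpace ℝ (Fin n)} (hx : x ∈ D) :
    Tendsto (fun p : ℕ × EuclideanSpace ℝ (Fin n) => gs p.1 p.2) (atTop ×ˢ 𝓝 x) (𝓝 (g x)) := by
  have hquad (u : Fin r → ℝ) :
      Tendsto (fun p : ℕ × EuclideanSpace ℝ (Fin n) => (gs p.1 p.2 *ᵥ u) ⬝ᵥ u)
        (atTop ×ˢ 𝓝 x) (𝓝 ((g x *ᵥ u) ⬝ᵥ u)) := by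
    have hc := continuous_mulVec_dotProduct u
    have hcg : ContinuousOn (fun y => (g y *ᵥ u) ⬝ᵥ u) D := hc.comp_continuousOn hg.continuousOn
    refine (tendstoLocallyUniformlyOn_iff_tendsto_prod
      (F := fun k y => (gs k y *ᵥ u) ⬝ᵥ u) hD hcg).1 ?_ x hx
    refine Monotone.tendstoLocallyUniformlyOn_of_forall_tendsto
      (fun k => hc.comp_continuousOn (hgs k).continuousOn) (fun y hy i j hij => ?_) hcg
      fun y hy => (hc.tendsto _).comp (hlim y hy)
    have := (hmono i j hij y hy).dotProduct_mulVec_nonneg u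
    rw [star_trivial, dotProduct_comm, Matrix.sub_mulVec, sub_dotProduct] at this
    exact sub_nonneg.1 this
  have hsymm {g' : EuclideanSpace ℝ (Fin n) → Matrix (Fin r) (Fin r) ℝ} (h : IsC2Metric D g')
      {y : EuclideanSpace ℝ (Fin n)} (hy : y ∈ D) (τ ξ : Fin r) : g' y τ ξ = g' y ξ τ := by
    simpa using ((h.posDef y hy).isHermitian.apply τ ξ).symm
  refine tendsto_pi_nhds.2 fun τ => tendsto_pi_nhds.2 fun ξ => ?_
  rw [apply_eq_polarization (hsymm hg hx) τ ξ]
  refine ((((hquad _).sub (hquad _)).sub (hquad _)).const_mul (1 / 2)).congr' ?_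
  filter_upwards [tendsto_snd.eventually (hD.mem_nhds hx)] with p hp
  exact (apply_eq_polarization (hsymm (hgs p.1) hp) τ ξ).symm

theorem tendsto_prod_inv_metric
    {gs : ℕ → EuclideanSpace ℝ (Fin n) → Matrix (Fin r) (Fin r) ℝ}
    {g : EuclideanSpace ℝ (Fin n) → Matrix (Fin r) (Fin r) ℝ} (hg : IsC2Metric D g)
    {x : EuclideanSpace ℝ (Fin n)} (hx : x ∈ D)
    (h : Tendsto (fun p : ℕ × EuclideanSpace ℝ (Fin n) => gs p.1 p.2) (atTop ×ˢ 𝓝 x) (𝓝 (g x))) :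
    Tendsto (fun p : ℕ × EuclideanSpace ℝ (Fin n) => (gs p.1 p.2)⁻¹)
      (atTop ×ˢ 𝓝 x) (𝓝 (g x)⁻¹) := by
  have hc : ContinuousAt (Ring.inverse : ℝ → ℝ) (g x).det := by
    rw [Ring.inverse_eq_inv']
    exact continuousAt_inv₀ (hg.isUnit_det hx).ne_zero
  exact (continuousAt_matrix_inv _ hc).tendsto.comp h

/-! ### Passing to the limit in the curvature -/

theorem IsC2Metric.contDiffOn_inv_mulVec_dotProduct
    {g : EuclideanSpace ℝ (Fin n) → Matrix (Fin r) (Fin r) ℝ} (hg : IsC2Metric D g)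
    (u : Fin r → ℝ) : ContDiffOn ℝ 2 (fun y => ((g y)⁻¹ *ᵥ u) ⬝ᵥ u) D := by
  simp only [dotProduct, Matrix.mulVec]
  exact ContDiffOn.sum fun τ _ => (ContDiffOn.sum fun ξ _ =>
    (hg.contDiffOn_inv τ ξ).mul contDiffOn_const).mul contDiffOn_const

theorem IsC2Metric.partialDeriv_inv_eq_polarization
    {g : EuclideanSpace ℝ (Fin n) → Matrix (Fin r) (Fin r) ℝ} (hD : IsOpen D)
    (hg : IsC2Metric D g) {x : EuclideanSpace ℝ (Fin n)} (hx : x ∈ D) (i : Fin n) (τ ξ : Fin r) :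
    partialDeriv i (fun y => (g y)⁻¹ τ ξ) x = (1 / 2) *
      (partialDeriv i (fun y => ((g y)⁻¹ *ᵥ (Pi.single τ 1 + Pi.single ξ 1)) ⬝ᵥ
          (Pi.single τ 1 + Pi.single ξ 1)) x -
        partialDeriv i (fun y => ((g y)⁻¹ *ᵥ Pi.single τ 1) ⬝ᵥ Pi.single τ 1) x -
        partialDeriv i (fun y => ((g y)⁻¹ *ᵥ Pi.single ξ 1) ⬝ᵥ Pi.single ξ 1) x) := by
  have hd (τ ξ) : DifferentiableAt ℝ (fun y => (g y)⁻¹ τ ξ) x :=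
    ((hg.contDiffOn_inv τ ξ).differentiableOn two_ne_zero).differentiableAt (hD.mem_nhds hx)
  simp only [partialDeriv_dotProduct_mulVec hd]
  refine apply_eq_polarization (A := matrixPartialDeriv i (fun y => (g y)⁻¹) x) (fun τ ξ => ?_) τ ξ
  refine partialDeriv_congr ?_ i
  filter_upwards [hD.mem_nhds hx] with y hy using hg.isSymm_inv hy τ ξ

theorem IsC2Metric.continuousOn_dualCoeff
    {g : EuclideanSpace ℝ (Fin n) → Matrix (Fin r) (Fin r) ℝ} (hD : IsOpen D)
    (hg : IsC2Metric D g) (i j : Fin n) (τ ξ : Fin r) :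
    ContinuousOn (fun x => dualCoeff g i j x τ ξ) D := by
  simp only [dualCoeff, Matrix.sub_apply, Matrix.mul_apply]
  refine (continuousOn_partialDeriv_partialDeriv hD (hg.contDiffOn_inv τ ξ) i j).sub
    (continuousOn_finsetSum _ fun b _ => (continuousOn_finsetSum _ fun a _ => ?_).mul ?_)
  · exact (continuousOn_partialDeriv hD (hg.contDiffOn_inv τ a) j).mul
      (hg.contDiffOn a b).continuousOn
  · exact continuousOn_partialDeriv hD (hg.contDiffOn_inv b ξ) i

theorem dualForm_eq_sum (g : EuclideanSpace ℝ (Fin n) → Matrix (Fin r) (Fin r) ℝ)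
    (β : FormFibre n r) (x : EuclideanSpace ℝ (Fin n)) :
    dualForm g β x = ∑ I, ∑ i, ∑ j, ∑ τ, ∑ ξ,
      (exchangeSign I i j * β (insert j (I.erase i)) ξ * β I τ) * dualCoeff g i j x τ ξ := by
  simp only [dualForm, dotProduct, Matrix.mulVec, Finset.sum_mul, Finset.mul_sum]
  refine Finset.sum_congr rfl fun I _ => Finset.sum_congr rfl fun i _ =>
    Finset.sum_congr rfl fun j _ => Finset.sum_congr rfl fun τ _ =>
    Finset.sum_congr rfl fun ξ _ => by ring

theorem IsC2Metric.continuousOn_dualForm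
    {g : EuclideanSpace ℝ (Fin n) → Matrix (Fin r) (Fin r) ℝ} (hD : IsOpen D)
    (hg : IsC2Metric D g) (β : FormFibre n r) : ContinuousOn (dualForm g β) D := by
  refine ContinuousOn.congr ?_ fun x _ => dualForm_eq_sum g β x
  exact continuousOn_finsetSum _ fun I _ => continuousOn_finsetSum _ fun i _ =>
    continuousOn_finsetSum _ fun j _ => continuousOn_finsetSum _ fun τ _ =>
    continuousOn_finsetSum _ fun ξ _ =>
      continuousOn_const.mul (hg.continuousOn_dualCoeff hD i j τ ξ)

theorem IsC2Metric.integral_mul_dualForm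
    {g : EuclideanSpace ℝ (Fin n) → Matrix (Fin r) (Fin r) ℝ} (hD : IsOpen D)
    (hg : IsC2Metric D g) (hχ : IsTestFunction D χ) (β : FormFibre n r) :
    ∫ x, χ x * dualForm g β x = ∑ I, ∑ i, ∑ j, ∑ τ, ∑ ξ,
      (exchangeSign I i j * β (insert j (I.erase i)) ξ * β I τ) *
        ∫ x, χ x * dualCoeff g i j x τ ξ := by
  have hi (c : ℝ) (i j τ ξ) : Integrable fun x => χ x * (c * dualCoeff g i j x τ ξ) :=
    hχ.integrable_mul hD (continuousOn_const.mul (hg.continuousOn_dualCoeff hD i j τ ξ))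
  simp only [dualForm_eq_sum, Finset.mul_sum]
  rw [integral_finsetSum _ fun I _ => integrable_finsetSum _ fun i _ =>
    integrable_finsetSum _ fun j _ => integrable_finsetSum _ fun τ _ =>
    integrable_finsetSum _ fun ξ _ => hi _ i j τ ξ]
  refine Finset.sum_congr rfl fun I _ => ?_
  rw [integral_finsetSum _ fun i _ =>
    integrable_finsetSum _ fun j _ => integrable_finsetSum _ fun τ _ =>
    integrable_finsetSum _ fun ξ _ => hi _ i j τ ξ]
  refine Finset.sum_congr rfl fun i _ => ?_
  rw [integral_finsetSum _ fun j _ => integrable_finsetSum _ fun τ _ =>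
    integrable_finsetSum _ fun ξ _ => hi _ i j τ ξ]
  refine Finset.sum_congr rfl fun j _ => ?_
  rw [integral_finsetSum _ fun τ _ => integrable_finsetSum _ fun ξ _ => hi _ i j τ ξ]
  refine Finset.sum_congr rfl fun τ _ => ?_
  rw [integral_finsetSum _ fun ξ _ => hi _ i j τ ξ]
  refine Finset.sum_congr rfl fun ξ _ => ?_
  rw [← integral_const_mul]
  exact integral_congr_ae (.of_forall fun x => by ring)

/-- The right-hand side involves no second derivative of the metric. -/
theorem IsC2Metric.integral_mul_dualCoeff
    {g : EuclideanSpace ℝ (Fin n) → Matrix (Fin r) (Fin r) ℝ} (hD : IsOpen D)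
    (hg : IsC2Metric D g) (hχ : IsTestFunction D χ) (i j : Fin n) (τ ξ : Fin r) :
    ∫ x, χ x * dualCoeff g i j x τ ξ =
      (∫ x, partialDeriv j (partialDeriv i χ) x * (g x)⁻¹ τ ξ) - ∑ b, ∑ a,
        ∫ x, χ x * (partialDeriv j (fun y => (g y)⁻¹ τ a) x * g x a b *
          partialDeriv i (fun y => (g y)⁻¹ b ξ) x) := by
  have hi (a b) : Integrable fun x => χ x * (partialDeriv j (fun y => (g y)⁻¹ τ a) x * g x a b *
      partialDeriv i (fun y => (g y)⁻¹ b ξ) x) :=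
    hχ.integrable_mul hD (((continuousOn_partialDeriv hD (hg.contDiffOn_inv τ a) j).mul
      (hg.contDiffOn a b).continuousOn).mul (continuousOn_partialDeriv hD (hg.contDiffOn_inv b ξ) i))
  rw [← integral_mul_partialDeriv_partialDeriv hD hχ (hg.contDiffOn_inv τ ξ) i j,
    Finset.sum_congr rfl fun b _ => (integral_finsetSum _ fun a _ => hi a b).symm,
    ← integral_finsetSum _ fun b _ => integrable_finsetSum _ fun a _ => hi a b,
    ← integral_sub (hχ.integrable_mul hD
      (continuousOn_partialDeriv_partialDeriv hD (hg.contDiffOn_inv τ ξ) i j))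
      (integrable_finsetSum _ fun b _ => integrable_finsetSum _ fun a _ => hi a b)]
  refine integral_congr_ae (.of_forall fun x => ?_)
  simp only [dualCoeff, Matrix.sub_apply, Matrix.mul_apply, matrixPartialDeriv, Matrix.of_apply,
    mul_sub, Finset.mul_sum, Finset.sum_mul]

theorem IsTestFunction.tendsto_integral_mul (hD : IsOpen D) (hχ : IsTestFunction D χ)
    {F : ℕ → EuclideanSpace ℝ (Fin n) → ℝ} {f : EuclideanSpace ℝ (Fin n) → ℝ}
    (hFc : ∀ k, ContinuousOn (F k) D) (hfc : ContinuousOn f D)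
    (hF : TendstoLocallyUniformlyOn F f atTop D) :
    Tendsto (fun k => ∫ x, χ x * F k x) atTop (𝓝 (∫ x, χ x * f x)) := by
  refine tendsto_integral_filter_of_dominated_convergence (fun x => |χ x| * (|f x| + 1))
    (.of_forall fun k => (hχ.continuous_mul hD (hFc k)).aestronglyMeasurable) ?_ ?_ ?_
  · filter_upwards [hχ.eventually_forall_abs_sub_lt hD hF one_pos] with k hk
    refine .of_forall fun x => ?_
    by_cases hx : x ∈ tsupport χ
    · have h1 := hk x hx
      have h2 := abs_sub_abs_le_abs_sub (F k x) (f x)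
      rw [Real.norm_eq_abs, abs_mul]
      gcongr
      linarith
    · simp [image_eq_zero_of_notMem_tsupport hx]
  · have : Integrable fun x => χ x * (|f x| + 1) :=
      hχ.integrable_mul hD (hfc.abs.add continuousOn_const)
    refine this.norm.congr (.of_forall fun x => ?_)
    simp only [norm_mul, Real.norm_eq_abs]
    rw [abs_of_nonneg (by positivity : 0 ≤ |f x| + 1)]
  · refine .of_forall fun x => ?_
    by_cases hx : x ∈ tsupport χ
    · exact (hF.tendsto_at (hχ.tsupport_subset hx)).const_mul _
    · simp [image_eq_zero_of_notMem_tsupport hx]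

/-- The first derivatives of the inverse metrics converge in `L²_loc`: polarize the scalar statement
`tendsto_integral_mul_partialDeriv_sub_sq` for the functions `⟨h_k u, u⟩`. -/
theorem tendsto_integral_mul_partialDeriv_inv_sub_sq {q : ℕ} (hq1 : 1 ≤ q) (hqn : q ≤ n)
    (hD : IsOpen D) (hχ : IsTestFunction D χ) (hχ0 : ∀ x, 0 ≤ χ x)
    {gs : ℕ → EuclideanSpace ℝ (Fin n) → Matrix (Fin r) (Fin r) ℝ}
    {g : EuclideanSpace ℝ (Fin n) → Matrix (Fin r) (Fin r) ℝ}
    (hgs : ∀ j, IsC2Metric D (gs j)) (hg : IsC2Metric D g)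
    (hpos : ∀ j, IsNakanoSemipositive q D (gs j))
    (hlim : ∀ x ∈ D, Tendsto (fun p : ℕ × EuclideanSpace ℝ (Fin n) => (gs p.1 p.2)⁻¹)
      (atTop ×ˢ 𝓝 x) (𝓝 (g x)⁻¹)) (i : Fin n) (a b : Fin r) :
    Tendsto (fun k => ∫ x, χ x * (partialDeriv i (fun y => (gs k y)⁻¹ a b) x -
      partialDeriv i (fun y => (g y)⁻¹ a b) x) ^ 2) atTop (𝓝 0) := by
  have hHquad (u : Fin r → ℝ) : TendstoLocallyUniformlyOn (fun k x => ((gs k x)⁻¹ *ᵥ u) ⬝ᵥ u)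
      (fun x => ((g x)⁻¹ *ᵥ u) ⬝ᵥ u) atTop D :=
    (tendstoLocallyUniformlyOn_iff_tendsto_prod hD
      (hg.contDiffOn_inv_mulVec_dotProduct u).continuousOn).2
      fun x hx => ((continuous_mulVec_dotProduct u).tendsto _).comp (hlim x hx)
  obtain ⟨I, hiI, -, hI⟩ := Finset.exists_subsuperset_card_eq (Finset.subset_univ {i})
    (by simpa using hq1) (by simpa using hqn)
  rw [Finset.singleton_subset_iff] at hiI
  have hq (u : Fin r → ℝ) := tendsto_integral_mul_partialDeriv_sub_sq hD hχ hχ0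
    (fun k => (hgs k).contDiffOn_inv_mulVec_dotProduct u)
    (hg.contDiffOn_inv_mulVec_dotProduct u) I
    (fun k x hx => (hpos k).sum_partialDeriv_inv_nonneg hD (hgs k) hx hI u) (hHquad u) hiI
  have hint (u : Fin r → ℝ) (k : ℕ) : Integrable fun x => χ x *
      (partialDeriv i (fun y => ((gs k y)⁻¹ *ᵥ u) ⬝ᵥ u) x -
        partialDeriv i (fun y => ((g y)⁻¹ *ᵥ u) ⬝ᵥ u) x) ^ 2 :=
    hχ.integrable_mul hD (((continuousOn_partialDeriv hD
      ((hgs k).contDiffOn_inv_mulVec_dotProduct u) i).sub (continuousOn_partialDeriv hD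
      (hg.contDiffOn_inv_mulVec_dotProduct u) i)).pow 2)
  have hsum := (((hq (Pi.single a 1 + Pi.single b 1)).add (hq (Pi.single a 1))).add
    (hq (Pi.single b 1))).const_mul (3 / 4)
  rw [add_zero, add_zero, mul_zero] at hsum
  refine squeeze_zero (fun k => integral_nonneg fun x => mul_nonneg (hχ0 x) (sq_nonneg _))
    (fun k => ?_) hsum
  have hi1 := hint (Pi.single a 1 + Pi.single b 1) k
  have hi2 := hint (Pi.single a 1) k
  have hi3 := hint (Pi.single b 1) k
  rw [← integral_add hi1 hi2, ← integral_add (by exact hi1.add hi2) hi3, ← integral_const_mul]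
  refine integral_mono (hχ.integrable_mul hD (((continuousOn_partialDeriv hD
      ((hgs k).contDiffOn_inv a b) i).sub (continuousOn_partialDeriv hD
      (hg.contDiffOn_inv a b) i)).pow 2)) (((hi1.add hi2).add hi3).const_mul _) fun x => ?_
  by_cases hx : x ∈ tsupport χ
  · have hxD := hχ.tsupport_subset hx
    simp only [(hgs k).partialDeriv_inv_eq_polarization hD hxD i a b,
      hg.partialDeriv_inv_eq_polarization hD hxD i a b]
    rw [← mul_add, ← mul_add, mul_left_comm]
    refine mul_le_mul_of_nonneg_left ?_ (hχ0 x)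
    generalize partialDeriv i _ x = a1
    generalize partialDeriv i _ x = a2
    generalize partialDeriv i _ x = a3
    generalize partialDeriv i _ x = b1
    generalize partialDeriv i _ x = b2
    generalize partialDeriv i _ x = b3
    nlinarith [sq_nonneg ((a1 - b1) + (a2 - b2)), sq_nonneg ((a1 - b1) + (a3 - b3)),
      sq_nonneg ((a2 - b2) - (a3 - b3))]
  · simp [image_eq_zero_of_notMem_tsupport hx]

/-- A continuous function which is nonnegative as a distribution is
nonnegative. -/
theorem nonneg_of_forall_integral_mul_nonneg (hD : IsOpen D)
    {f : EuclideanSpace ℝ (Fin n) → ℝ} (hf : ContinuousOn f D)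
    (h : ∀ χ, IsTestFunction D χ → (∀ x, 0 ≤ χ x) → 0 ≤ ∫ x, χ x * f x)
    {x : EuclideanSpace ℝ (Fin n)} (hx : x ∈ D) : 0 ≤ f x := by
  by_contra! hneg
  have hev : ∀ᶠ y in 𝓝 x, y ∈ D ∧ f y < 0 :=
    (hD.eventually_mem hx).and ((hf.continuousAt (hD.mem_nhds hx)).eventually (gt_mem_nhds hneg))
  obtain ⟨ρ, hρ, hball⟩ := Metric.nhds_basis_closedBall.eventually_iff.1 hev
  let φ : ContDiffBump x := ⟨ρ / 2, ρ, by positivity, by linarith⟩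
  have hφ : IsTestFunction D φ := ⟨φ.contDiff, φ.hasCompactSupport, by
    rw [φ.tsupport_eq]; exact fun y hy => (hball hy).1⟩
  have h1 := h φ hφ fun y => φ.nonneg
  have h2 : 0 < ∫ y, φ y * -f y := by
    refine (hφ.continuous_mul hD hf.neg).integral_pos_of_hasCompactSupport_nonneg_nonzero
      hφ.hasCompactSupport.mul_right (fun y => ?_) (x := x) ?_
    · by_cases hy : y ∈ tsupport φ
      · rw [φ.tsupport_eq] at hy
        exact mul_nonneg φ.nonneg (neg_nonneg.2 (hball hy).2.le)
      · simp [image_eq_zero_of_notMem_tsupport hy]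
    · simp [φ.one_of_mem_closedBall (Metric.mem_closedBall_self φ.rIn_pos.le), hneg.ne]
  simp only [mul_neg, integral_neg] at h2
  linarith

end RiemannianBundle

open RiemannianBundle MeasureTheory in
theorem theorem1p2 {n r q : ℕ} (hq1 : 1 ≤ q) (hqn : q ≤ n)
    (D : Set (EuclideanSpace ℝ (Fin n))) (hDo : IsOpen D) (hDc : IsConnected D)
    (gs : ℕ → EuclideanSpace ℝ (Fin n) → Matrix (Fin r) (Fin r) ℝ)
    (g : EuclideanSpace ℝ (Fin n) → Matrix (Fin r) (Fin r) ℝ)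
    (hgs : ∀ j, RiemannianBundle.IsC2Metric D (gs j))
    (hg : RiemannianBundle.IsC2Metric D g)
    (hpos : ∀ j, RiemannianBundle.IsNakanoSemipositive q D (gs j))
    (hmono : ∀ i j, i ≤ j → ∀ x ∈ D, (gs j x - gs i x).PosSemidef)
    (hle : ∀ j, ∀ x ∈ D, (g x - gs j x).PosSemidef)
    (hlim : ∀ x ∈ D, Tendsto (fun j => gs j x) atTop (𝓝 (g x))) :
    RiemannianBundle.IsNakanoSemipositive q D g := by
  have hG {x} (hx : x ∈ D) := tendsto_prod_metric hDo hgs hg hmono hlim hx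
  have hH {x} (hx : x ∈ D) := tendsto_prod_inv_metric hg hx (hG hx)
  have hGu (a b : Fin r) :
      TendstoLocallyUniformlyOn (fun k x => gs k x a b) (fun x => g x a b) atTop D :=
    (tendstoLocallyUniformlyOn_iff_tendsto_prod hDo (hg.contDiffOn a b).continuousOn).2
      fun x hx => tendsto_pi_nhds.1 (tendsto_pi_nhds.1 (hG hx) a) b
  have hHu (a b : Fin r) :
      TendstoLocallyUniformlyOn (fun k x => (gs k x)⁻¹ a b) (fun x => (g x)⁻¹ a b) atTop D :=
    (tendstoLocallyUniformlyOn_iff_tendsto_prod hDo (hg.contDiffOn_inv a b).continuousOn).2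
      fun x hx => tendsto_pi_nhds.1 (tendsto_pi_nhds.1 (hH hx) a) b
  have main (β : FormFibre n r) (hβ : β.IsDegree q) (χ : EuclideanSpace ℝ (Fin n) → ℝ)
      (hχ : IsTestFunction D χ) (hχ0 : ∀ x, 0 ≤ χ x) : 0 ≤ ∫ x, χ x * dualForm g β x := by
    have hL2 := tendsto_integral_mul_partialDeriv_inv_sub_sq hq1 hqn hDo hχ hχ0 hgs hg hpos
      fun x => hH
    have hcoeff (i j : Fin n) (τ ξ : Fin r) :
        Tendsto (fun k => ∫ x, χ x * dualCoeff (gs k) i j x τ ξ) atTop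
          (𝓝 (∫ x, χ x * dualCoeff g i j x τ ξ)) := by
      simp only [hg.integral_mul_dualCoeff hDo hχ, (hgs _).integral_mul_dualCoeff hDo hχ]
      refine (((hχ.partialDeriv i).partialDeriv j).tendsto_integral_mul hDo
        (fun k => ((hgs k).contDiffOn_inv τ ξ).continuousOn) (hg.contDiffOn_inv τ ξ).continuousOn
        (hHu τ ξ)).sub (tendsto_finsetSum _ fun b _ => tendsto_finsetSum _ fun a _ => ?_)
      exact tendsto_integral_mul_mul_mul hDo hχ hχ0
        (fun k => continuousOn_partialDeriv hDo ((hgs k).contDiffOn_inv τ a) j)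
        (fun k => continuousOn_partialDeriv hDo ((hgs k).contDiffOn_inv b ξ) i)
        (fun k => ((hgs k).contDiffOn a b).continuousOn)
        (continuousOn_partialDeriv hDo (hg.contDiffOn_inv τ a) j)
        (continuousOn_partialDeriv hDo (hg.contDiffOn_inv b ξ) i)
        (hg.contDiffOn a b).continuousOn (hL2 j τ a) (hL2 i b ξ) (hGu a b)
    have hform : Tendsto (fun k => ∫ x, χ x * dualForm (gs k) β x) atTop
        (𝓝 (∫ x, χ x * dualForm g β x)) := by
      simp only [hg.integral_mul_dualForm hDo hχ, (hgs _).integral_mul_dualForm hDo hχ]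
      exact tendsto_finsetSum _ fun I _ => tendsto_finsetSum _ fun i _ =>
        tendsto_finsetSum _ fun j _ => tendsto_finsetSum _ fun τ _ =>
        tendsto_finsetSum _ fun ξ _ => (hcoeff i j τ ξ).const_mul _
    refine ge_of_tendsto' hform fun k => integral_nonneg fun x => ?_
    by_cases hx : x ∈ tsupport χ
    · exact mul_nonneg (hχ0 x)
        ((hpos k).dualForm_nonneg hDo (hgs k) (hχ.tsupport_subset hx) hβ)
    · simp [image_eq_zero_of_notMem_tsupport hx]
  intro x hx α hα
  rw [hg.fibreInner_curvatureOperator hDo hx]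
  -- Extend the value of `g α` at `x` to a constant `β`.
  exact nonneg_of_forall_integral_mul_nonneg hDo (hg.continuousOn_dualForm hDo _)
    (main _ fun I hI => by simp [hα I hI]) hx
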